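/- An online graph is a finite simple graph $G$ with vertices $v_1,\dots,v_n$ revealed one by one in this order; when $v_i$ is revealed, all edges between $v_i$ and $v_1,\dots,v_{i-1}$ are revealed with it. Let $\alpha\in\mathbf{R}_{\ge 0}$. In the Delayed Feedback Vertex Set problem with reservations, a (deterministic) online algorithm chooses, for every $i$, knowing only $G[\{v_1,\dots,v_i\}]$, sets $S_i,R_i\subseteq\{v_1,\dots,v_i\}$ of selected and reserved vertices such that $S_1\subseteq\dots\subseteq S_n$, $R_1\subseteq\dots\subseteq R_n$, and $G[\{v_1,\dots,v_i\}\setminus(S_i\cup R_i)]$ is cycle-free. Its cost on $G$ is $|S_n|+|T|+\alpha|R_n|$, where $T\subseteq V(G)$ is a smallest vertex set such that $G-(S_n\cup T)$ is cycle-free. The (strict) competitive ratio of the algorithm is the supremum, over all online graphs $G$, of its cost on $G$ divided by the minimum size of a feedback vertex set of $G$, where $0/0=0$ and $x/0=\infty$ for $x>0$. Then for every $\alpha\ge 0$, no algorithm for Delayed Feedback Vertex Set with reservations has a competitive ratio smaller than $\min\{1+3\alpha,4\}$. -/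

import Mathlib

open scoped NNReal ENNReal

namespace DelayedFVS

/-- Deleting the vertex set `S` from `G` leaves a cycle-free graph. -/
def CycleFreeWithout {n : ℕ} (G : SimpleGraph (Fin n)) (S : Finset (Fin n)) : Prop :=
  (G.induce ((S : Set (Fin n))ᶜ)).IsAcyclic

/-- An online graph is a graph on `Fin n`, its vertices being ordered by their arrival.
`onlinePrefix G h` is the graph induced by the first `m` vertices. -/
def onlinePrefix {m n : ℕ} (G : SimpleGraph (Fin n)) (h : m ≤ n) : SimpleGraph (Fin m) :=
  G.comap (Fin.castLE h)

/-- The least number of vertices that, deleted in addition to `S`, leave a cycle-free graph.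
(The set is nonempty: delete all vertices.) -/
noncomputable def completionNumber {n : ℕ} (G : SimpleGraph (Fin n)) (S : Finset (Fin n)) : ℕ :=
  sInf {k : ℕ | ∃ T : Finset (Fin n), T.card = k ∧ CycleFreeWithout G (S ∪ T)}

/-- The optimal offline cost: the size of a minimum feedback vertex set. -/
noncomputable def offlineOpt {n : ℕ} (G : SimpleGraph (Fin n)) : ℕ :=
  completionNumber G ∅

/-- A deterministic online algorithm for Delayed Feedback Vertex Set with reservations.
`select G` and `reserve G` are the sets of selected and of reserved vertices at the moment at
which the graph revealed so far is `G`; they are a function of this graph alone. -/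
structure ReservationAlgorithm where
  select : ∀ {n : ℕ}, SimpleGraph (Fin n) → Finset (Fin n)
  reserve : ∀ {n : ℕ}, SimpleGraph (Fin n) → Finset (Fin n)
  /-- Selections are irrevocable. -/
  select_mono : ∀ {m n : ℕ} (G : SimpleGraph (Fin n)) (h : m ≤ n),
    (select (onlinePrefix G h)).map (Fin.castLEEmb h) ⊆ select G
  /-- Reservations are irrevocable. -/
  reserve_mono : ∀ {m n : ℕ} (G : SimpleGraph (Fin n)) (h : m ≤ n),
    (reserve (onlinePrefix G h)).map (Fin.castLEEmb h) ⊆ reserve G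
  /-- At every moment the selected and reserved vertices together hit all cycles. -/
  valid : ∀ {n : ℕ} (G : SimpleGraph (Fin n)), CycleFreeWithout G (select G ∪ reserve G)

/-- The cost `|S| + |T| + α |R|` when the instance ends with the graph `G`: here `S` is the set of
selected vertices, `T` a minimum completion of `S` and `R` the set of reserved vertices. -/
noncomputable def ReservationAlgorithm.cost (A : ReservationAlgorithm) (α : ℝ≥0) {n : ℕ}
    (G : SimpleGraph (Fin n)) : ℝ≥0 :=
  (A.select G).card + completionNumber G (A.select G) + α * (A.reserve G).card

/-- The strict competitive ratio: the supremum over all instances of the cost divided by the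
optimal offline cost, with the conventions `0 / 0 = 0` and `x / 0 = ∞` for `x > 0`. -/
noncomputable def ReservationAlgorithm.competitiveRatio (A : ReservationAlgorithm)
    (α : ℝ≥0) : ℝ≥0∞ :=
  ⨆ (n : ℕ) (G : SimpleGraph (Fin n)), (A.cost α G : ℝ≥0∞) / (offlineOpt G : ℝ≥0∞)

end DelayedFVS

/-!
The adversary maintains a set `W` and a path each vertex of which completes `W` to a feedback
vertex set. In each round it adds a fresh long cycle, which has to be hit. Unless the algorithm
has already given up far too many vertices, an edge of the path and an edge of the cycle are then
untouched. A hexagon through these two edges has to be hit as well, and leaves one of them, `u v`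
say, untouched. A triangle on `u v` forces the deletion of `u`, `v` or its apex, and a further
triangle at an end `c` of `u v` forces one more. Since `c` lies on the hexagon and on both
triangles, it can join `W`, and the path or the cycle, whichever does not contain `c`, is the next
path. Hence the optimum grows by one per round while the algorithm gives up four vertices, so that
`S ∪ R` has at least `4 k + 1` vertices when the optimum is at most `k + 1`.

The cost `|S| + |T| + α |R|` is bounded by combining `opt ≤ |S| + |T|` with weight `1 - β` and
`|S| + |R| ≤ |S| + |T| + |R|` with weight `β = min α 1`. This yields the ratio
`(1 - β) + β (4 k + 1) / (k + 1)`, which tends to `1 + 3 β` as `k` grows.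
-/

namespace DelayedFVS

open Filter Finset SimpleGraph Topology

section FeedbackVertexSet

variable {V W : Type*} {G G' : SimpleGraph V} {H : SimpleGraph W}

/-- A *core* of `G`: a nonempty finite vertex set inducing a subgraph of minimum degree at least
two. It certifies a cycle without exhibiting a closed walk. -/
def IsCore (G : SimpleGraph V) (S : Finset V) : Prop :=
  S.Nonempty ∧ ∀ v ∈ S, ((S : Set V) ∩ G.neighborSet v).Nontrivial

lemma IsCore.mono {S : Finset V} (hG : G ≤ G') (hS : IsCore G S) : IsCore G' S :=
  ⟨hS.1, fun v hv => (hS.2 v hv).mono fun _ hw => ⟨hw.1, hG hw.2⟩⟩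

lemma IsCore.map {S : Finset V} (f : V ↪ W) (hS : IsCore (H.comap f) S) : IsCore H (S.map f) := by
  refine ⟨hS.1.map, fun v hv => ?_⟩
  obtain ⟨x, hx, rfl⟩ := mem_map.mp hv
  refine ((hS.2 x hx).image f.injective).mono ?_
  rintro _ ⟨y, ⟨hy, hxy⟩, rfl⟩
  exact ⟨mem_map_of_mem f hy, hxy⟩

lemma IsCore.comap {S : Finset W} (f : V ↪ W) (hf : (S : Set W) ⊆ Set.range f) (hS : IsCore H S) :
    IsCore (H.comap f) (S.preimage f f.injective.injOn) := by
  refine ⟨?_, fun x hx => ?_⟩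
  · obtain ⟨v, hv⟩ := hS.1
    obtain ⟨x, rfl⟩ := hf hv
    exact ⟨x, mem_preimage.mpr hv⟩
  · obtain ⟨a, ⟨ha, hxa⟩, b, ⟨hb, hxb⟩, hab⟩ := hS.2 (f x) (mem_preimage.mp hx)
    obtain ⟨a, rfl⟩ := hf ha
    obtain ⟨b, rfl⟩ := hf hb
    exact ⟨a, ⟨mem_preimage.mpr ha, hxa⟩, b, ⟨mem_preimage.mpr hb, hxb⟩, fun h => hab (h ▸ rfl)⟩

lemma exists_subsingleton_neighborSet_of_isAcyclic [Finite V] [Nonempty V] (hG : G.IsAcyclic) :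
    ∃ v, (G.neighborSet v).Subsingleton := by
  -- An end of a longest path has no neighbour besides the next vertex of the path.
  obtain ⟨u, v, p, hp, hmax⟩ := Walk.exists_isPath_forall_isPath_length_le_length G
  have eq_snd (w : V) (huw : G.Adj u w) : w = p.snd := by
    refine hG.eq_snd_of_adj_start hp huw ?_
    by_contra hw
    have := hmax _ _ _ (hp.cons (h := huw.symm) hw)
    simp at this
  exact ⟨u, fun a ha b hb => (eq_snd a ha).trans (eq_snd b hb).symm⟩

lemma IsCore.not_isAcyclic {S : Finset V} (hS : IsCore G S) : ¬ G.IsAcyclic := by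
  intro hG
  have : Nonempty (S : Set V) := hS.1.to_subtype
  obtain ⟨x, hx⟩ := exists_subsingleton_neighborSet_of_isAcyclic (hG.induce (S : Set V))
  obtain ⟨a, ⟨ha, hxa⟩, b, ⟨hb, hxb⟩, hab⟩ := hS.2 x x.2
  exact hab (congrArg Subtype.val (hx (x := ⟨a, ha⟩) hxa (y := ⟨b, hb⟩) hxb))

lemma isAcyclic_iff_forall_not_isCore : G.IsAcyclic ↔ ∀ S, ¬ IsCore G S := by
  classical
  refine ⟨fun hG S hS => hS.not_isAcyclic hG,
    fun h v c hc => h c.support.toFinset ⟨⟨v, by simp⟩, ?_⟩⟩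
  intro x hx
  have hcard := hc.ncard_neighborSet_toSubgraph_eq_two (List.mem_toFinset.mp hx)
  obtain ⟨a, ha, b, hb, hab⟩ := (Set.one_lt_ncard (Set.finite_of_ncard_pos (by omega))).mp
    (by omega : 1 < (c.toSubgraph.neighborSet x).ncard)
  have mem {y : V} (hy : c.toSubgraph.Adj x y) :
      y ∈ ((c.support.toFinset : Set V) ∩ G.neighborSet x) :=
    ⟨by simpa using c.mem_verts_toSubgraph.mp hy.snd_mem, hy.adj_sub⟩
  exact ⟨a, mem ha, b, mem hb, hab⟩

/-- `F` is a feedback vertex set of `G`. On `Fin n` this is `CycleFreeWithout`; here the vertices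
form an arbitrary type, as the adversary works with graphs on `ℕ`. -/
def IsFeedbackVertexSet (G : SimpleGraph V) (F : Finset V) : Prop :=
  (G.induce (F : Set V)ᶜ).IsAcyclic

lemma isFeedbackVertexSet_iff {F : Finset V} :
    IsFeedbackVertexSet G F ↔ ∀ S, IsCore G S → ∃ v ∈ S, v ∈ F := by
  rw [IsFeedbackVertexSet, isAcyclic_iff_forall_not_isCore]
  constructor
  · intro h S hS
    by_contra! hSF
    exact h _ (hS.comap (Function.Embedding.subtype _) fun v hv => ⟨⟨v, hSF v hv⟩, rfl⟩)
  · intro h S hS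
    obtain ⟨v, hv, hvF⟩ := h _ (hS.map (Function.Embedding.subtype _))
    obtain ⟨x, -, rfl⟩ := mem_map.mp hv
    exact x.2 hvF

lemma IsFeedbackVertexSet.anti {F : Finset V} (hG : G ≤ G') (hF : IsFeedbackVertexSet G' F) :
    IsFeedbackVertexSet G F :=
  IsAcyclic.anti (comap_monotone _ hG) hF

lemma IsFeedbackVertexSet.mono {F F' : Finset V} (hF : IsFeedbackVertexSet G F) (hFF' : F ⊆ F') :
    IsFeedbackVertexSet G F' :=
  isFeedbackVertexSet_iff.mpr fun S hS =>
    let ⟨v, hv, hvF⟩ := isFeedbackVertexSet_iff.mp hF S hS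
    ⟨v, hv, hFF' hvF⟩

lemma IsFeedbackVertexSet.comap {F : Finset W} (f : V ↪ W) (hF : IsFeedbackVertexSet H F) :
    IsFeedbackVertexSet (H.comap f) (F.preimage f f.injective.injOn) := by
  refine isFeedbackVertexSet_iff.mpr fun S hS => ?_
  obtain ⟨v, hv, hvF⟩ := isFeedbackVertexSet_iff.mp hF _ (hS.map f)
  obtain ⟨x, hx, rfl⟩ := mem_map.mp hv
  exact ⟨x, hx, mem_preimage.mpr hvF⟩

/-- Outside of `F`, the graph `G'` arises from `G` by adding leaves in the order of their rank `r`,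
the vertices of `G` being those of rank zero. -/
lemma IsFeedbackVertexSet.of_rank {F : Finset V} (hF : IsFeedbackVertexSet G F) (r : V → ℕ)
    (hle : ∀ v w, r v = 0 → r w = 0 → G'.Adj v w → G.Adj v w)
    (hleaf : ∀ v ∉ F, r v ≠ 0 → {w | w ∉ F ∧ G'.Adj v w ∧ r w ≤ r v}.Subsingleton) :
    IsFeedbackVertexSet G' F := by
  refine isFeedbackVertexSet_iff.mpr fun S hS => ?_
  by_contra! hSF
  obtain ⟨v, hvS, hv⟩ := S.exists_max_image r hS.1
  by_cases hv0 : r v = 0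
  · have hr (w : V) (hw : w ∈ S) : r w = 0 := Nat.le_zero.mp (hv0 ▸ hv w hw)
    have hSG : IsCore G S := ⟨hS.1, fun x hx => (hS.2 x hx).mono fun y ⟨hy, hxy⟩ =>
      ⟨hy, hle x y (hr x hx) (hr y hy) hxy⟩⟩
    obtain ⟨w, hw, hwF⟩ := isFeedbackVertexSet_iff.mp hF S hSG
    exact hSF w hw hwF
  · refine (Set.not_subsingleton_iff.mpr (hS.2 v hvS)) ((hleaf v (hSF v hvS) hv0).anti ?_)
    exact fun w ⟨hw, hvw⟩ => ⟨hSF w hw, hvw, hv w hw⟩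

end FeedbackVertexSet

section Ear

variable {V : Type*} {G : SimpleGraph V} {w x y : V}

/-- Join the vertex `w` to `x` and `y`. For a new vertex `w` this appends an ear to `G`, or a
pendant edge if `x = y`. -/
def addEar (G : SimpleGraph V) (w x y : V) : SimpleGraph V :=
  G ⊔ edge w x ⊔ edge w y

lemma addEar_adj {a b : V} : (addEar G w x y).Adj a b ↔
    G.Adj a b ∨ a ≠ b ∧ (a = w ∧ (b = x ∨ b = y) ∨ b = w ∧ (a = x ∨ a = y)) := by
  simp only [addEar, sup_adj, edge_adj]
  tauto

lemma le_addEar : G ≤ addEar G w x y :=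
  le_sup_left.trans le_sup_left

lemma addEar_swap : addEar G w x y = addEar G w y x :=
  sup_right_comm _ _ _

lemma addEar_comm {w' x' y' : V} :
    addEar (addEar G w x y) w' x' y' = addEar (addEar G w' x' y') w x y := by
  simp only [addEar]
  ac_rfl

lemma support_addEar_subset {s : Set V} (hG : G.support ⊆ s) (hw : w ∈ s) (hx : x ∈ s)
    (hy : y ∈ s) : (addEar G w x y).support ⊆ s := by
  rintro a ⟨b, hab⟩
  rcases addEar_adj.mp hab with h | ⟨-, ⟨rfl, -⟩ | ⟨-, rfl | rfl⟩⟩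
  exacts [hG ⟨b, h⟩, hw, hx, hy]

lemma notMem_support_addEar {v : V} (hG : v ∉ G.support) (hw : v ≠ w) (hx : v ≠ x) (hy : v ≠ y) :
    v ∉ (addEar G w x y).support :=
  Set.subset_compl_singleton_iff.mp (support_addEar_subset (Set.subset_compl_singleton_iff.mpr hG)
    hw.symm hx.symm hy.symm)

lemma isCore_addEar [DecidableEq V] (hxy : G.Adj x y) (hwx : w ≠ x) (hwy : w ≠ y) :
    IsCore (addEar G w x y) {x, y, w} := by
  have hwx' : (addEar G w x y).Adj w x := addEar_adj.mpr (.inr ⟨hwx, by simp⟩)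
  have hwy' : (addEar G w x y).Adj w y := addEar_adj.mpr (.inr ⟨hwy, by simp⟩)
  have hxy' : (addEar G w x y).Adj x y := le_addEar hxy
  refine ⟨insert_nonempty _ _, fun v hv => ?_⟩
  simp only [mem_insert, mem_singleton] at hv
  rcases hv with rfl | rfl | rfl
  · exact ⟨y, ⟨by simp, hxy'⟩, w, ⟨by simp, hwx'.symm⟩, hwy.symm⟩
  · exact ⟨x, ⟨by simp, hxy'.symm⟩, w, ⟨by simp, hwy'.symm⟩, hwx.symm⟩
  · exact ⟨x, ⟨by simp, hwx'⟩, y, ⟨by simp, hwy'⟩, hxy.ne⟩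

lemma IsFeedbackVertexSet.addEar {F : Finset V} (hF : IsFeedbackVertexSet G F)
    (hw : w ∉ G.support) (hxy : x ∈ F ∨ y ∈ F ∨ x = y) :
    IsFeedbackVertexSet (addEar G w x y) F := by
  classical
  refine hF.of_rank (fun v => if v = w then 1 else 0) ?_ ?_
  · intro a b ha hb hab
    grind [addEar_adj]
  · rintro v - hv a ⟨haF, ha, -⟩ b ⟨hbF, hb, -⟩
    obtain rfl : v = w := by grind
    have hG (z : V) : ¬ G.Adj v z := fun h => hw ⟨z, h⟩
    grind [addEar_adj]

end Ear
section Cycle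

/-- The cycle through the vertices `n, n + 1, …, n + L - 1`. -/
def cycleOn (n L : ℕ) : SimpleGraph ℕ :=
  fromRel fun x y => n ≤ x ∧ x < y ∧ y < n + L ∧ (y = x + 1 ∨ x = n ∧ y + 1 = n + L)

lemma cycleOn_adj_succ {n L x : ℕ} (hn : n ≤ x) (hL : x + 1 < n + L) :
    (cycleOn n L).Adj x (x + 1) :=
  ⟨by omega, .inl ⟨hn, by omega, hL, .inl rfl⟩⟩

lemma cycleOn_adj_last {n L : ℕ} (hL : 2 ≤ L) : (cycleOn n L).Adj n (n + L - 1) :=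
  ⟨by omega, .inl ⟨le_rfl, by omega, by omega, .inr ⟨rfl, by omega⟩⟩⟩

lemma mem_Ico_of_cycleOn_adj {n L x y : ℕ} (h : (cycleOn n L).Adj x y) : x ∈ Ico n (n + L) := by
  simp only [cycleOn, fromRel_adj] at h
  rw [mem_Ico]
  omega

lemma isCore_cycleOn {n L : ℕ} (hL : 3 ≤ L) : IsCore (cycleOn n L) (Ico n (n + L)) := by
  refine ⟨nonempty_Ico.mpr (by omega), fun v hv => ?_⟩
  have mem {a : ℕ} (h : (cycleOn n L).Adj v a) :
      a ∈ (Ico n (n + L) : Set ℕ) ∩ (cycleOn n L).neighborSet v :=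
    ⟨mem_Ico_of_cycleOn_adj h.symm, h⟩
  obtain ⟨hn, hv⟩ := mem_Ico.mp hv
  have succ (h : v + 1 < n + L) : (cycleOn n L).Adj v (v + 1) := cycleOn_adj_succ hn h
  have pred (h : n < v) : (cycleOn n L).Adj v (v - 1) := by
    simpa [Nat.sub_add_cancel (Nat.one_le_of_lt h)] using
      (cycleOn_adj_succ (n := n) (L := L) (x := v - 1) (by omega) (by omega)).symm
  have last : (cycleOn n L).Adj n (n + L - 1) := cycleOn_adj_last (by omega)
  rcases hn.eq_or_lt with rfl | hnv
  · exact ⟨_, mem (succ (by omega)), _, mem last, by omega⟩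
  · rcases (Nat.succ_le_of_lt hv).eq_or_lt with hv' | hv'
    · obtain rfl : v = n + L - 1 := by omega
      exact ⟨_, mem last.symm, _, mem (pred hnv), by omega⟩
    · exact ⟨_, mem (succ hv'), _, mem (pred hnv), by omega⟩

/-- The position of `x` in the cycle `cycleOn n L`, when `b` is the last vertex. -/
def cyclePosition (L b x : ℕ) : ℕ :=
  if b < x then x - b else x + L - b

lemma cyclePosition_of_adj {n L b x y : ℕ} (hb : b ∈ Ico n (n + L)) (hx : x ≠ b) (hy : y ≠ b)
    (hxy : (cycleOn n L).Adj x y) : cyclePosition L b y = cyclePosition L b x + 1 ∨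
      cyclePosition L b x = cyclePosition L b y + 1 := by
  simp only [cycleOn, fromRel_adj] at hxy
  rw [mem_Ico] at hb
  unfold cyclePosition
  split_ifs <;> omega

lemma cyclePosition_injOn {n L b : ℕ} (hb : b ∈ Ico n (n + L)) :
    Set.InjOn (cyclePosition L b) (Ico n (n + L)) := by
  intro x hx y hy hxy
  simp only [coe_Ico, Set.mem_Ico, mem_Ico] at hb hx hy
  unfold cyclePosition at hxy
  split_ifs at hxy <;> omega

/-- The distance from `p` to `x` along the path that `cycleOn n L` becomes without `b`. -/
def cycleDist (L b p x : ℕ) : ℕ :=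
  Nat.dist (cyclePosition L b x) (cyclePosition L b p)

lemma cycleDist_lt_of_adj {n L b p x : ℕ} (hb : b ∈ Ico n (n + L)) (hp : p ≠ b) (hx : x ≠ b)
    (hpx : (cycleOn n L).Adj p x) : cycleDist L b p p < cycleDist L b p x := by
  have := cyclePosition_of_adj hb hp hx hpx
  simp only [cycleDist, Nat.dist]
  omega

lemma subsingleton_cycleOn_adj_cycleDist_le {n L b p v : ℕ} (hb : b ∈ Ico n (n + L)) (hv : v ≠ b) :
    {x | x ≠ b ∧ (cycleOn n L).Adj v x ∧
      cycleDist L b p x ≤ cycleDist L b p v}.Subsingleton := by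
  rintro x ⟨hxb, hvx, hx⟩ y ⟨hyb, hvy, hy⟩
  have := cyclePosition_of_adj hb hv hxb hvx
  have := cyclePosition_of_adj hb hv hyb hvy
  simp only [cycleDist, Nat.dist] at hx hy
  exact cyclePosition_injOn hb (mem_Ico_of_cycleOn_adj hvx.symm)
    (mem_Ico_of_cycleOn_adj hvy.symm) (by omega)

variable {H : SimpleGraph ℕ} {F : Finset ℕ} {n L b : ℕ}

lemma IsFeedbackVertexSet.addEar_sup_cycleOn {w p p' : ℕ} (hF : IsFeedbackVertexSet H F)
    (hH : H.support ⊆ Set.Iio n) (hb : b ∈ Ico n (n + L)) (hbF : b ∈ F)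
    (hp : p ∉ Ico n (n + L)) (hp' : p' ∈ Ico n (n + L)) (hw : n + L ≤ w) :
    IsFeedbackVertexSet (DelayedFVS.addEar (H ⊔ cycleOn n L) w p p') F := by
  have hHn {x y : ℕ} (h : H.Adj x y) : x < n := hH ⟨y, h⟩
  have ne_b {x : ℕ} (hx : x ∉ F) : x ≠ b := fun h => hx (h ▸ hbF)
  have adj_iff {x y : ℕ} := addEar_adj (G := H ⊔ cycleOn n L) (w := w) (x := p) (y := p')
    (a := x) (b := y)
  simp only [sup_adj] at adj_iff
  -- First `w` is a leaf at `p`; then the cycle without `b` grows in both directions from `p'`.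
  let r (x : ℕ) : ℕ :=
    if x = w then 1 else if x ∈ Ico n (n + L) then cycleDist L b p' x + 2 else 0
  have mem_Ico_of_adj {x y : ℕ} (h : (cycleOn n L).Adj x y) :
      x ∈ Ico n (n + L) ∧ y ∈ Ico n (n + L) :=
    ⟨mem_Ico_of_cycleOn_adj h, mem_Ico_of_cycleOn_adj h.symm⟩
  refine hF.of_rank r ?_ ?_
  · intro x y hx hy hxy
    grind
  · rintro v hvF hv
    rcases eq_or_ne v w with rfl | hvw
    · refine Set.subsingleton_of_subset_singleton (a := p) ?_
      rintro x ⟨-, hvx, hxv⟩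
      grind
    · rcases eq_or_ne v p' with rfl | hvp'
      · refine Set.subsingleton_of_subset_singleton (a := w) ?_
        rintro x ⟨hxF, hvx, hxv⟩
        have := cycleDist_lt_of_adj hb (ne_b hvF) (ne_b hxF)
        grind
      · refine (subsingleton_cycleOn_adj_cycleDist_le (p := p') hb (ne_b hvF)).anti ?_
        rintro x ⟨hxF, hvx, hxv⟩
        suffices (cycleOn n L).Adj v x ∧ cycleDist L b p' x ≤ cycleDist L b p' v from
          ⟨ne_b hxF, this⟩
        grind

lemma IsFeedbackVertexSet.sup_cycleOn (hF : IsFeedbackVertexSet H F) (hH : H.support ⊆ Set.Iio n)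
    (hb : b ∈ Ico n (n + L)) (hbF : b ∈ F) : IsFeedbackVertexSet (H ⊔ cycleOn n L) F :=
  (hF.addEar_sup_cycleOn hH hb hbF (p := n + L) (by simp) hb le_rfl).anti le_addEar

lemma support_sup_cycleOn_subset (hH : H.support ⊆ Set.Iio n) :
    (H ⊔ cycleOn n L).support ⊆ Set.Iio (n + L) := by
  rintro x ⟨y, hxy | hxy⟩
  · exact Nat.lt_add_right L (hH ⟨y, hxy⟩)
  · exact (mem_Ico.mp (mem_Ico_of_cycleOn_adj hxy)).2

end Cycle
section DeletionStrategy

/-- The online graph on the first `n` vertices of `H`. -/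
def truncate (H : SimpleGraph ℕ) (n : ℕ) : SimpleGraph (Fin n) :=
  H.comap Fin.valEmbedding

lemma truncate_eq_of_forall_adj_iff {H H' : SimpleGraph ℕ} {n : ℕ}
    (h : ∀ x < n, ∀ y < n, (H.Adj x y ↔ H'.Adj x y)) : truncate H n = truncate H' n := by
  ext x y
  exact h x x.2 y y.2

lemma truncate_addEar {H : SimpleGraph ℕ} {n w x y : ℕ} (hw : n ≤ w) :
    truncate (addEar H w x y) n = truncate H n := by
  refine truncate_eq_of_forall_adj_iff fun a ha b hb => ?_
  rw [addEar_adj, or_iff_left]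
  omega

lemma truncate_sup_cycleOn {H : SimpleGraph ℕ} {n L : ℕ} :
    truncate (H ⊔ cycleOn n L) n = truncate H n := by
  refine truncate_eq_of_forall_adj_iff fun a ha b _ => ?_
  rw [sup_adj, or_iff_left]
  intro hab
  have := mem_Ico.mp (mem_Ico_of_cycleOn_adj hab)
  omega

lemma CycleFreeWithout.exists_val_mem {H : SimpleGraph ℕ} {n : ℕ} {F : Finset (Fin n)}
    (hF : CycleFreeWithout (truncate H n) F) {S : Finset ℕ} (hSn : S ⊆ range n)
    (hS : IsCore H S) : ∃ x ∈ F, (x : ℕ) ∈ S := by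
  have hrange : (S : Set ℕ) ⊆ Set.range (Fin.valEmbedding : Fin n ↪ ℕ) := fun v hv =>
    ⟨⟨v, mem_range.mp (hSn hv)⟩, rfl⟩
  obtain ⟨x, hx, hxF⟩ := isFeedbackVertexSet_iff.mp hF _ (hS.comap Fin.valEmbedding hrange)
  exact ⟨x, hxF, mem_preimage.mp hx⟩

/-- An online algorithm reduced to the set `deleted H n` of the vertices it has given up, be it by
selection or by reservation, at the moment at which the first `n` vertices of `H` are revealed. -/
structure DeletionStrategy where
  deleted : SimpleGraph ℕ → ℕ → Finset ℕ
  deleted_subset_range : ∀ H n, deleted H n ⊆ range n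
  deleted_mono : ∀ {H H' : SimpleGraph ℕ} {m n : ℕ}, m ≤ n → truncate H' m = truncate H m →
    deleted H m ⊆ deleted H' n
  exists_mem_deleted : ∀ {H : SimpleGraph ℕ} {n : ℕ} {S : Finset ℕ}, S ⊆ range n → IsCore H S →
    ∃ v ∈ S, v ∈ deleted H n

/-- The vertices given up by an algorithm with reservations are the selected and the reserved
ones. -/
noncomputable def ReservationAlgorithm.toDeletionStrategy (A : ReservationAlgorithm) :
    DeletionStrategy where
  deleted H n := (A.select (truncate H n) ∪ A.reserve (truncate H n)).map Fin.valEmbedding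
  deleted_subset_range H n v hv := by
    obtain ⟨x, -, rfl⟩ := mem_map.mp hv
    exact mem_range.mpr x.2
  deleted_mono {H H' m n} hmn hH v hv := by
    obtain ⟨x, hx, rfl⟩ := mem_map.mp hv
    have hselect := A.select_mono (truncate H' n) hmn
    have hreserve := A.reserve_mono (truncate H' n) hmn
    rw [show onlinePrefix (truncate H' n) hmn = truncate H m from hH] at hselect hreserve
    refine mem_map.mpr ⟨Fin.castLE hmn x, ?_, rfl⟩
    rcases mem_union.mp hx with hx | hx
    · exact mem_union_left _ (hselect (mem_map_of_mem (Fin.castLEEmb hmn) hx))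
    · exact mem_union_right _ (hreserve (mem_map_of_mem (Fin.castLEEmb hmn) hx))
  exists_mem_deleted hSn hS := by
    obtain ⟨x, hx, hxS⟩ := (A.valid _).exists_val_mem hSn hS
    exact ⟨x, hxS, mem_map_of_mem Fin.valEmbedding hx⟩

variable (D : DeletionStrategy) {H : SimpleGraph ℕ} {m n w x y : ℕ}

lemma DeletionStrategy.deleted_subset_addEar (hmw : m ≤ w) (hmn : m ≤ n) :
    D.deleted H m ⊆ D.deleted (addEar H w x y) n :=
  D.deleted_mono hmn (truncate_addEar hmw)

lemma DeletionStrategy.card_deleted_lt_sup_cycleOn {L : ℕ} (hL : 3 ≤ L) :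
    #(D.deleted H n) < #(D.deleted (H ⊔ cycleOn n L) (n + L)) := by
  obtain ⟨v, hv, hvD⟩ := D.exists_mem_deleted (n := n + L) (fun x => by simp)
    ((isCore_cycleOn (n := n) hL).mono (le_sup_right (a := H)))
  refine card_lt_card ((ssubset_iff_of_subset ?_).mpr ⟨v, hvD, fun hvn => ?_⟩)
  · exact D.deleted_mono (n.le_add_right L) truncate_sup_cycleOn
  · exact (mem_range.mp (D.deleted_subset_range _ _ hvn)).not_ge (mem_Ico.mp hv).1

end DeletionStrategy

section Gadgets

variable {H G : SimpleGraph ℕ} {F : Finset ℕ} {n L N b c d p q p' q' : ℕ}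

/-- Join `p` to `p'` by a path through `N`, and `q` to `q'` by a path through `N + 1`. If `p, q` and
`p', q'` are edges, this closes a hexagon. -/
def addHexagon (G : SimpleGraph ℕ) (N p q p' q' : ℕ) : SimpleGraph ℕ :=
  addEar (addEar G N p p') (N + 1) q q'

lemma le_addHexagon : G ≤ addHexagon G N p q p' q' :=
  le_addEar.trans le_addEar

lemma support_addHexagon_subset (hG : G.support ⊆ Set.Iio N) (hp : p < N) (hq : q < N)
    (hp' : p' < N) (hq' : q' < N) : (addHexagon G N p q p' q').support ⊆ Set.Iio (N + 2) :=
  support_addEar_subset (support_addEar_subset (hG.trans (Set.Iio_subset_Iio (by omega)))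
    (by simp) (by simp; omega) (by simp; omega)) (by simp) (by simp; omega) (by simp; omega)

lemma isCore_addHexagon (hpq : G.Adj p q) (hpq' : G.Adj p' q') (hpp' : p ≠ p') (hqq' : q ≠ q')
    (hp : p < N) (hq : q < N) (hp' : p' < N) (hq' : q' < N) :
    IsCore (addHexagon G N p q p' q') {p, q, p', q', N, N + 1} := by
  have adj_p : (addHexagon G N p q p' q').Adj N p := le_addEar (addEar_adj.mpr (by grind))
  have adj_p' : (addHexagon G N p q p' q').Adj N p' := le_addEar (addEar_adj.mpr (by grind))
  have adj_q : (addHexagon G N p q p' q').Adj (N + 1) q := addEar_adj.mpr (by grind)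
  have adj_q' : (addHexagon G N p q p' q').Adj (N + 1) q' := addEar_adj.mpr (by grind)
  have adj_pq := le_addHexagon (N := N) (p := p) (q := q) (p' := p') (q' := q') hpq
  have adj_pq' := le_addHexagon (N := N) (p := p) (q := q) (p' := p') (q' := q') hpq'
  refine ⟨insert_nonempty _ _, fun v hv => ?_⟩
  simp only [mem_insert, mem_singleton] at hv
  rcases hv with rfl | rfl | rfl | rfl | rfl | rfl
  · exact ⟨q, ⟨by simp, adj_pq⟩, N, ⟨by simp, adj_p.symm⟩, by omega⟩
  · exact ⟨p, ⟨by simp, adj_pq.symm⟩, N + 1, ⟨by simp, adj_q.symm⟩, by omega⟩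
  · exact ⟨q', ⟨by simp, adj_pq'⟩, N, ⟨by simp, adj_p'.symm⟩, by omega⟩
  · exact ⟨p', ⟨by simp, adj_pq'.symm⟩, N + 1, ⟨by simp, adj_q'.symm⟩, by omega⟩
  · exact ⟨p, ⟨by simp, adj_p⟩, p', ⟨by simp, adj_p'⟩, hpp'⟩
  · exact ⟨q, ⟨by simp, adj_q⟩, q', ⟨by simp, adj_q'⟩, hqq'⟩

lemma IsFeedbackVertexSet.addHexagon_sup_cycleOn (hF : IsFeedbackVertexSet H F)
    (hH : H.support ⊆ Set.Iio n) (hb : b ∈ Ico n (n + L)) (hbF : b ∈ F) (hp : p < n) (hq : q < n)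
    (hp' : p' ∈ Ico n (n + L)) (hq' : q' ∈ Ico n (n + L))
    (hpq : p ∈ F ∨ q ∈ F ∨ p' ∈ F ∨ q' ∈ F) :
    IsFeedbackVertexSet (addHexagon (H ⊔ cycleOn n L) (n + L) p q p' q') F := by
  have notMem_support {v : ℕ} (hv : n + L ≤ v) : v ∉ (H ⊔ cycleOn n L).support := fun h =>
    hv.not_gt (support_sup_cycleOn_subset hH h)
  have hp₁ : p ∉ Ico n (n + L) := fun h => hp.not_ge (mem_Ico.mp h).1
  have hq₁ : q ∉ Ico n (n + L) := fun h => hq.not_ge (mem_Ico.mp h).1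
  -- One of the two ears has an end in `F`, so only the other one can close a new cycle.
  obtain h | h : (p ∈ F ∨ p' ∈ F) ∨ q ∈ F ∨ q' ∈ F := by tauto
  · rw [addHexagon, addEar_comm]
    refine (hF.addEar_sup_cycleOn hH hb hbF hq₁ hq' (by omega)).addEar ?_ (by tauto)
    exact notMem_support_addEar (notMem_support le_rfl) (by omega) (by omega) (by grind)
  · refine (hF.addEar_sup_cycleOn hH hb hbF hp₁ hp' le_rfl).addEar ?_ (by tauto)
    exact notMem_support_addEar (notMem_support (by omega)) (by omega) (by omega) (by grind)

/-- Attach two triangles that share the vertex `c`, the first one on the edge `c, d`, the second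
one on two new vertices. The edge from `c` to `N + 1` is encoded as an ear with equal ends. -/
def addTriangles (G : SimpleGraph ℕ) (N c d : ℕ) : SimpleGraph ℕ :=
  addEar (addEar (addEar G N c d) (N + 1) c c) (N + 2) c (N + 1)

lemma le_addTriangles : G ≤ addTriangles G N c d :=
  le_addEar.trans (le_addEar.trans le_addEar)

lemma support_addTriangles_subset (hG : G.support ⊆ Set.Iio N) (hc : c < N) (hd : d < N) :
    (addTriangles G N c d).support ⊆ Set.Iio (N + 3) := by
  refine support_addEar_subset (support_addEar_subset (support_addEar_subset ?_ ?_ ?_ ?_) ?_ ?_ ?_)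
    ?_ ?_ ?_
  · exact hG.trans (Set.Iio_subset_Iio (by omega))
  all_goals rw [Set.mem_Iio]; omega

lemma IsFeedbackVertexSet.addTriangles (hF : IsFeedbackVertexSet G F)
    (hG : G.support ⊆ Set.Iio N) (hc : c < N) (hd : d < N) (hcF : c ∈ F) :
    IsFeedbackVertexSet (addTriangles G N c d) F := by
  have notMem_support {v : ℕ} (hv : N ≤ v) : v ∉ G.support := fun h => hv.not_gt (hG h)
  refine ((hF.addEar (notMem_support le_rfl) (.inl hcF)).addEar ?_ (.inl hcF)).addEar ?_ (.inl hcF)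
  · exact notMem_support_addEar (notMem_support (by omega)) (by omega) (by omega) (by omega)
  · exact notMem_support_addEar (notMem_support_addEar (notMem_support (by omega)) (by omega)
      (by omega) (by omega)) (by omega) (by omega) (by omega)

/-- One round of the adversary: a fresh cycle, a hexagon joining the edge `p, q` of the old graph to
the edge `p', q'` of that cycle, and two triangles at an end `c` of one of these edges. -/
def addRound (H : SimpleGraph ℕ) (n L p q p' q' c d : ℕ) : SimpleGraph ℕ :=
  addTriangles (addHexagon (H ⊔ cycleOn n L) (n + L) p q p' q') (n + L + 2) c d

lemma sup_cycleOn_le_addRound : H ⊔ cycleOn n L ≤ addRound H n L p q p' q' c d :=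
  le_addHexagon.trans le_addTriangles

lemma support_addRound_subset (hH : H.support ⊆ Set.Iio n) (hp : p < n) (hq : q < n)
    (hp' : p' ∈ Ico n (n + L)) (hq' : q' ∈ Ico n (n + L)) (hc : c < n + L) (hd : d < n + L) :
    (addRound H n L p q p' q' c d).support ⊆ Set.Iio (n + L + 5) := by
  rw [mem_Ico] at hp' hq'
  exact support_addTriangles_subset (support_addHexagon_subset (support_sup_cycleOn_subset hH)
    (by omega) (by omega) (by omega) (by omega)) (by omega) (by omega)

lemma IsFeedbackVertexSet.addRound (hF : IsFeedbackVertexSet H F) (hH : H.support ⊆ Set.Iio n)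
    (hb : b ∈ Ico n (n + L)) (hbF : b ∈ F) (hp : p < n) (hq : q < n) (hp' : p' ∈ Ico n (n + L))
    (hq' : q' ∈ Ico n (n + L)) (hc : c = p ∨ c = q ∨ c = p' ∨ c = q') (hd : d < n + L)
    (hcF : c ∈ F) : IsFeedbackVertexSet (addRound H n L p q p' q' c d) F := by
  have hpqF : p ∈ F ∨ q ∈ F ∨ p' ∈ F ∨ q' ∈ F := by
    rcases hc with rfl | rfl | rfl | rfl <;> simp [hcF]
  refine (hF.addHexagon_sup_cycleOn hH hb hbF hp hq hp' hq' hpqF).addTriangles ?_ ?_ ?_ hcF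
  all_goals rw [mem_Ico] at hp' hq'
  · exact support_addHexagon_subset (support_sup_cycleOn_subset hH) (by omega) (by omega)
      (by omega) (by omega)
  all_goals omega

end Gadgets

section Forcing

variable (D : DeletionStrategy) {G : SimpleGraph ℕ} {N c d u v p q p' q' : ℕ}

lemma DeletionStrategy.deleted_addEar_subset_addTriangles :
    D.deleted (addEar G N c d) (N + 1) ⊆ D.deleted (addTriangles G N c d) (N + 3) :=
  (D.deleted_subset_addEar (n := N + 2) le_rfl (by omega)).trans
    (D.deleted_subset_addEar (by omega) (by omega))

lemma DeletionStrategy.exists_mem_deleted_addTriangles (hc : c < N) :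
    ∃ e ∈ D.deleted (addTriangles G N c d) (N + 3), e = c ∨ e = N + 1 ∨ e = N + 2 := by
  have adj : (addEar (addEar G N c d) (N + 1) c c).Adj c (N + 1) := addEar_adj.mpr (by grind)
  obtain ⟨e, he, heD⟩ := D.exists_mem_deleted (n := N + 3) (by grind)
    (isCore_addEar (w := N + 2) adj (by omega) (by omega))
  exact ⟨e, heD, by simpa using he⟩

/-- The triangle on `u, v` forces the deletion of `u`, `v` or `N`. If an end `c` of the edge
survives that, then the triangle through `c` and two new vertices forces another deletion. Otherwise
both ends are gone. -/
lemma DeletionStrategy.exists_card_add_two_le_addTriangles (huv : G.Adj u v) (hu : u < N)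
    (hv : v < N) {A : Finset ℕ} (hA : A ⊆ D.deleted G N) (huA : u ∉ A) (hvA : v ∉ A) :
    ∃ c d, s(c, d) = s(u, v) ∧ #A + 2 ≤ #(D.deleted (addTriangles G N c d) (N + 3)) := by
  have lt_of_mem {x : ℕ} (hx : x ∈ A) : x < N := mem_range.mp (D.deleted_subset_range G N (hA hx))
  obtain ⟨e, he, heD⟩ := D.exists_mem_deleted (n := N + 1) (by grind)
    (isCore_addEar (w := N) huv hu.ne' hv.ne')
  have heN : e < N + 1 := mem_range.mp (D.deleted_subset_range _ _ heD)
  have heA : e ∉ A := by grind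
  have deleted_subset {c d : ℕ} (hcd : s(c, d) = s(u, v)) :
      D.deleted (addEar G N u v) (N + 1) ⊆ D.deleted (addTriangles G N c d) (N + 3) := by
    rcases Sym2.eq_iff.mp hcd with ⟨rfl, rfl⟩ | ⟨rfl, rfl⟩
    · exact D.deleted_addEar_subset_addTriangles
    · exact addEar_swap (G := G) ▸ D.deleted_addEar_subset_addTriangles
  obtain ⟨c, d, hcd, e', he'D, he', he'A⟩ : ∃ c d, s(c, d) = s(u, v) ∧
      ∃ e' ∈ D.deleted (addTriangles G N c d) (N + 3), e' ≠ e ∧ e' ∉ A := by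
    by_cases h : ∃ c d, s(c, d) = s(u, v) ∧ c ∉ D.deleted (addEar G N u v) (N + 1)
    · obtain ⟨c, d, hcd, hcD⟩ := h
      obtain ⟨e', he'D, he'⟩ := D.exists_mem_deleted_addTriangles (G := G) (d := d)
        (show c < N by grind)
      exact ⟨c, d, hcd, e', he'D, by grind⟩
    · push Not at h
      have huD := deleted_subset rfl (h u v rfl)
      have hvD := deleted_subset rfl (h v u Sym2.eq_swap)
      have := huv.ne
      rcases eq_or_ne e u with rfl | heu
      · exact ⟨e, v, rfl, v, hvD, by grind⟩
      · exact ⟨u, v, rfl, u, huD, by grind⟩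
  refine ⟨c, d, hcd, ?_⟩
  calc #A + 2 = #(insert e' (insert e A)) := by
        rw [card_insert_of_notMem (by simp [he', he'A]), card_insert_of_notMem heA]
    _ ≤ _ := card_le_card (insert_subset he'D (insert_subset (deleted_subset hcd heD)
      ((hA.trans (D.deleted_subset_addEar le_rfl (by omega))).trans (deleted_subset hcd))))

/-- An edge of the graph revealed so far that has not lost an end. -/
structure DeletionStrategy.IsFreeEdge (D : DeletionStrategy) (G : SimpleGraph ℕ) (N p q : ℕ) :
    Prop where
  adj : G.Adj p q
  left_lt : p < N
  right_lt : q < N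
  left_notMem : p ∉ D.deleted G N
  right_notMem : q ∉ D.deleted G N

lemma DeletionStrategy.exists_card_add_three_le_addTriangles (hpq : D.IsFreeEdge G N p q)
    (hpq' : D.IsFreeEdge G N p' q') (hdisj : Disjoint ({p, q} : Finset ℕ) {p', q'}) :
    ∃ c d, (s(c, d) = s(p, q) ∨ s(c, d) = s(p', q')) ∧ #(D.deleted G N) + 3 ≤
      #(D.deleted (addTriangles (addHexagon G N p q p' q') (N + 2) c d) (N + 5)) := by
  obtain ⟨hadj, hp, hq, hpD, hqD⟩ := hpq
  obtain ⟨hadj', hp', hq', hpD', hqD'⟩ := hpq'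
  obtain ⟨⟨hpp', hqp'⟩, hp_q', hqq'⟩ : (p ≠ p' ∧ q ≠ p') ∧ p ≠ q' ∧ q ≠ q' := by
    simpa [eq_comm] using hdisj
  obtain ⟨e, he, heD⟩ := D.exists_mem_deleted (n := N + 2)
    (by simp only [insert_subset_iff, singleton_subset_iff, mem_range]; omega)
    (isCore_addHexagon hadj hadj' hpp' hqq' hp hq hp' hq')
  simp only [mem_insert, mem_singleton] at he
  have heN : e ∉ D.deleted G N := fun h => by
    have := mem_range.mp (D.deleted_subset_range G N h)
    rcases he with rfl | rfl | rfl | rfl | rfl | rfl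
    exacts [hpD h, hqD h, hpD' h, hqD' h, by omega, by omega]
  have hA : insert e (D.deleted G N) ⊆ D.deleted (addHexagon G N p q p' q') (N + 2) :=
    insert_subset heD ((D.deleted_subset_addEar (n := N + 1) le_rfl (by omega)).trans
      (D.deleted_subset_addEar le_rfl (by omega)))
  have card_insert : #(insert e (D.deleted G N)) + 2 = #(D.deleted G N) + 3 := by
    rw [card_insert_of_notMem heN]
  by_cases hepq : e = p ∨ e = q
  · obtain ⟨c, d, hcd, h⟩ := D.exists_card_add_two_le_addTriangles (le_addHexagon hadj')
      (by omega) (by omega) hA (by rw [mem_insert]; grind) (by rw [mem_insert]; grind)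
    exact ⟨c, d, .inr hcd, card_insert.symm.trans_le h⟩
  · obtain ⟨c, d, hcd, h⟩ := D.exists_card_add_two_le_addTriangles (le_addHexagon hadj)
      (by omega) (by omega) hA (by rw [mem_insert]; grind) (by rw [mem_insert]; grind)
    exact ⟨c, d, .inl hcd, card_insert.symm.trans_le h⟩

end Forcing

section Adversary

lemma exists_consecutive_notMem {A : Finset ℕ} {M : ℕ} (hA : #A < M) (s : ℕ) :
    ∃ p, s ≤ p ∧ p + 1 < s + 2 * M ∧ p ∉ A ∧ p + 1 ∉ A := by
  by_contra! h
  have hM : range M ⊆ A.image fun x => (x - s) / 2 := fun i hi => by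
    rw [mem_range] at hi
    by_cases hiA : s + 2 * i ∈ A
    · exact mem_image.mpr ⟨_, hiA, by omega⟩
    · exact mem_image.mpr ⟨_, h _ (by omega) (by omega) hiA, by omega⟩
  have := (card_le_card hM).trans card_image_le
  rw [card_range] at this
  omega

/-- Some online graph containing a cycle makes `D` delete at least `M` vertices although it has a
feedback vertex set of size at most `K`. -/
def DeletionStrategy.Forces (D : DeletionStrategy) (K M : ℕ) : Prop :=
  ∃ (H : SimpleGraph ℕ) (n : ℕ) (F : Finset ℕ), H.support ⊆ Set.Iio n ∧ ¬ H.IsAcyclic ∧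
    IsFeedbackVertexSet H F ∧ #F ≤ K ∧ M ≤ #(D.deleted H n)

/-- The situation after `k` rounds of the adversary. The optimum is at most `k + 1`, and the vertex
completing `W` to a feedback vertex set may be any vertex of the path `s, s + 1, …, s + L - 1`. -/
structure DeletionStrategy.IsStage (D : DeletionStrategy) (L k : ℕ) (H : SimpleGraph ℕ)
    (n s : ℕ) (W : Finset ℕ) : Prop where
  support_subset : H.support ⊆ Set.Iio n
  not_isAcyclic : ¬ H.IsAcyclic
  card_le : #W ≤ k
  path_le : s + L ≤ n
  path_adj : ∀ x, s ≤ x → x + 1 < s + L → H.Adj x (x + 1)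
  isFeedbackVertexSet : ∀ x ∈ Ico s (s + L), IsFeedbackVertexSet H (insert x W)
  lt_card_deleted : 4 * k < #(D.deleted H n)

variable {D : DeletionStrategy} {H : SimpleGraph ℕ} {W : Finset ℕ}
  {L M k n s p q p' q' c d : ℕ}

lemma DeletionStrategy.isStage_zero (hL : 3 ≤ L) :
    D.IsStage L 0 (⊥ ⊔ cycleOn 0 L) (0 + L) 0 ∅ where
  support_subset := support_sup_cycleOn_subset (by simp)
  not_isAcyclic := ((isCore_cycleOn hL).mono le_sup_right).not_isAcyclic
  card_le := le_rfl
  path_le := le_rfl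
  path_adj x hx hxL := le_sup_right (a := (⊥ : SimpleGraph ℕ)) (cycleOn_adj_succ hx hxL)
  isFeedbackVertexSet x hx :=
    IsFeedbackVertexSet.sup_cycleOn (isAcyclic_bot.induce _) (by simp) hx
      (mem_insert_self x ∅)
  lt_card_deleted := (Nat.zero_le _).trans_lt (D.card_deleted_lt_sup_cycleOn hL)

namespace DeletionStrategy.IsStage

lemma forces (hstage : D.IsStage L k H n s W) (hL : 0 < L)
    (hM : M ≤ #(D.deleted (H ⊔ cycleOn n L) (n + L))) : D.Forces (k + 2) M := by
  have hs := hstage.isFeedbackVertexSet s (by rw [mem_Ico]; omega)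
  refine ⟨_, _, insert n (insert s W), support_sup_cycleOn_subset hstage.support_subset,
    fun h => hstage.not_isAcyclic (h.anti le_sup_left), ?_, ?_, hM⟩
  · exact (hs.mono (subset_insert _ _)).sup_cycleOn hstage.support_subset
      (by rw [mem_Ico]; omega) (mem_insert_self _ _)
  · have := hstage.card_le
    have := card_insert_le n (insert s W)
    have := card_insert_le s W
    omega

/-- If `c` lies on the old path, then `insert c W` hits all old cycles and any vertex of the new
cycle completes it. Otherwise `c` hits the new cycle and any vertex of the old path completes it. -/
lemma addRound (hstage : D.IsStage L k H n s W) (hp : p ∈ Ico s (s + L)) (hq : q ∈ Ico s (s + L))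
    (hp' : p' ∈ Ico n (n + L)) (hq' : q' ∈ Ico n (n + L))
    (hcd : s(c, d) = s(p, q) ∨ s(c, d) = s(p', q'))
    (hcard : 4 * (k + 1) < #(D.deleted (addRound H n L p q p' q' c d) (n + L + 5))) :
    ∃ s', D.IsStage L (k + 1) (addRound H n L p q p' q' c d) (n + L + 5) s' (insert c W) := by
  have hn := hstage.path_le
  have hH := hstage.support_subset
  have le_round : H ⊔ cycleOn n L ≤ DelayedFVS.addRound H n L p q p' q' c d :=
    sup_cycleOn_le_addRound
  have hc : c = p ∨ c = q ∨ c = p' ∨ c = q' := by grind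
  have hcW : #(insert c W) ≤ k + 1 := (card_insert_le _ _).trans (by simpa using hstage.card_le)
  have hacyclic : ¬ (DelayedFVS.addRound H n L p q p' q' c d).IsAcyclic := fun h =>
    hstage.not_isAcyclic (h.anti (le_sup_left.trans le_round))
  have hpn : p < n := (mem_Ico.mp hp).2.trans_le hn
  have hqn : q < n := (mem_Ico.mp hq).2.trans_le hn
  have hd : d < n + L := by grind
  have hsupport := support_addRound_subset hH hpn hqn hp' hq' (show c < n + L by grind) hd
  obtain hc_old | hc_new : c ∈ Ico s (s + L) ∨ c ∈ Ico n (n + L) := by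
    rcases hc with rfl | rfl | rfl | rfl <;> simp [*]
  · refine ⟨n, hsupport, hacyclic, hcW, by omega, fun x hx hxL => ?_, fun x hx => ?_, hcard⟩
    · exact le_round (le_sup_right (a := H) (cycleOn_adj_succ hx hxL))
    · exact ((hstage.isFeedbackVertexSet c hc_old).mono (subset_insert x _)).addRound hH hx
        (by simp) hpn hqn hp' hq' hc hd (by simp)
  · refine ⟨s, hsupport, hacyclic, hcW, by omega, fun x hx hxL => ?_, fun x hx => ?_, hcard⟩
    · exact le_round (le_sup_left (a := H) (hstage.path_adj x hx hxL))
    · exact ((hstage.isFeedbackVertexSet x hx).mono (insert_subset_insert x (subset_insert c W))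
        ).addRound hH hc_new (by simp) hpn hqn hp' hq' hc hd (by simp)

lemma exists_succ (hstage : D.IsStage (2 * M) k H n s W) (hM : 2 ≤ M)
    (hcard : #(D.deleted (H ⊔ cycleOn n (2 * M)) (n + 2 * M)) < M) :
    ∃ H n s W, D.IsStage (2 * M) (k + 1) H n s W := by
  have hn := hstage.path_le
  have hk := hstage.lt_card_deleted
  have hcycle := D.card_deleted_lt_sup_cycleOn (H := H) (n := n) (L := 2 * M) (by omega)
  obtain ⟨p, hsp, hps, hpD, hqD⟩ := exists_consecutive_notMem hcard s
  obtain ⟨p', hnp', hpn', hpD', hqD'⟩ := exists_consecutive_notMem hcard n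
  obtain ⟨c, d, hcd, hcard'⟩ := D.exists_card_add_three_le_addTriangles
    ⟨le_sup_left (a := H) (hstage.path_adj p hsp hps), by omega, by omega, hpD, hqD⟩
    ⟨le_sup_right (a := H) (cycleOn_adj_succ hnp' hpn'), by omega, by omega, hpD', hqD'⟩
    (by simp; omega)
  obtain ⟨s', hstage'⟩ := hstage.addRound (p := p) (q := p + 1) (p' := p') (q' := p' + 1)
    (by rw [mem_Ico]; omega) (by rw [mem_Ico]; omega) (by rw [mem_Ico]; omega)
    (by rw [mem_Ico]; omega) hcd (lt_of_lt_of_le (by omega) hcard')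
  exact ⟨_, _, s', _, hstage'⟩

end DeletionStrategy.IsStage

lemma DeletionStrategy.Forces.mono {K K' : ℕ} (h : D.Forces K M) (hK : K ≤ K') :
    D.Forces K' M := by
  obtain ⟨H, n, F, hH, hcyc, hF, hFK, hM⟩ := h
  exact ⟨H, n, F, hH, hcyc, hF, hFK.trans hK, hM⟩

lemma DeletionStrategy.forces_or_exists_isStage (D : DeletionStrategy) (hM : 2 ≤ M) (k : ℕ) :
    D.Forces (k + 1) M ∨ ∃ H n s W, D.IsStage (2 * M) k H n s W := by
  induction k with
  | zero => exact .inr ⟨_, _, _, _, isStage_zero (by omega)⟩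
  | succ k ih =>
    obtain h | ⟨H, n, s, W, hstage⟩ := ih
    · exact .inl (h.mono (by omega))
    · obtain hcard | hcard := le_or_gt M #(D.deleted (H ⊔ cycleOn n (2 * M)) (n + 2 * M))
      · exact .inl (hstage.forces (by omega) hcard)
      · exact .inr (hstage.exists_succ hM hcard)

theorem DeletionStrategy.forces_succ (D : DeletionStrategy) (k : ℕ) :
    D.Forces (k + 1) (4 * k + 1) := by
  obtain ⟨H, n, F, hH, hcyc, hF, hFk, hM⟩ | ⟨H, n, s, W, hstage⟩ :=
    D.forces_or_exists_isStage (M := 4 * k + 2) (by omega) k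
  · exact ⟨H, n, F, hH, hcyc, hF, hFk, by omega⟩
  · refine ⟨H, n, insert s W, hstage.support_subset, hstage.not_isAcyclic,
      hstage.isFeedbackVertexSet s (by rw [mem_Ico]; omega), ?_, hstage.lt_card_deleted⟩
    exact (card_insert_le _ _).trans (by simpa using hstage.card_le)

end Adversary

section Cost

variable {n : ℕ} {G : SimpleGraph (Fin n)} {H : SimpleGraph ℕ}

lemma exists_card_eq_completionNumber (G : SimpleGraph (Fin n)) (S : Finset (Fin n)) :
    ∃ T : Finset (Fin n), #T = completionNumber G S ∧ CycleFreeWithout G (S ∪ T) := by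
  refine Nat.sInf_mem (s := {k | ∃ T : Finset (Fin n), #T = k ∧ CycleFreeWithout G (S ∪ T)})
    ⟨_, univ, rfl, ?_⟩
  have : IsEmpty (((S ∪ univ : Finset (Fin n)) : Set (Fin n))ᶜ : Set (Fin n)) :=
    ⟨fun x => x.2 (by simp)⟩
  exact IsAcyclic.of_subsingleton

lemma CycleFreeWithout.offlineOpt_le_card {F : Finset (Fin n)} (hF : CycleFreeWithout G F) :
    offlineOpt G ≤ #F :=
  Nat.sInf_le ⟨F, rfl, by rwa [empty_union]⟩

lemma offlineOpt_le_card_add_completionNumber (G : SimpleGraph (Fin n)) (S : Finset (Fin n)) :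
    offlineOpt G ≤ #S + completionNumber G S := by
  obtain ⟨T, hT, hST⟩ := exists_card_eq_completionNumber G S
  exact hT ▸ hST.offlineOpt_le_card.trans (card_union_le S T)

lemma offlineOpt_pos (hG : ¬ G.IsAcyclic) : 0 < offlineOpt G := by
  obtain ⟨T, hT, hfree⟩ := exists_card_eq_completionNumber G ∅
  rw [isAcyclic_iff_forall_not_isCore] at hG
  push Not at hG
  obtain ⟨S, hS⟩ := hG
  rw [empty_union] at hfree
  obtain ⟨x, -, hx⟩ := isFeedbackVertexSet_iff.mp hfree S hS
  exact (card_pos.mpr ⟨x, hx⟩).trans_eq hT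

lemma IsFeedbackVertexSet.offlineOpt_truncate_le {F : Finset ℕ} (hF : IsFeedbackVertexSet H F) :
    offlineOpt (truncate H n) ≤ #F :=
  (CycleFreeWithout.offlineOpt_le_card (hF.comap Fin.valEmbedding)).trans
    (card_le_card_of_injOn _ (fun _ hx => mem_preimage.mp hx) Fin.val_injective.injOn)

lemma isAcyclic_of_truncate (hH : H.support ⊆ Set.Iio n) (hn : (truncate H n).IsAcyclic) :
    H.IsAcyclic := by
  refine isAcyclic_iff_forall_not_isCore.mpr fun S hS => ?_
  refine (hS.comap Fin.valEmbedding fun v hv => ?_).not_isAcyclic hn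
  obtain ⟨w, ⟨-, hvw⟩, -⟩ := hS.2 v hv
  exact ⟨⟨v, hH ⟨w, hvw⟩⟩, rfl⟩

namespace ReservationAlgorithm

variable (A : ReservationAlgorithm) {α β : ℝ≥0}

lemma exists_le_card_select_add_card_reserve (k : ℕ) :
    ∃ (n : ℕ) (G : SimpleGraph (Fin n)), 0 < offlineOpt G ∧ offlineOpt G ≤ k + 1 ∧
      4 * k + 1 ≤ #(A.select G) + #(A.reserve G) := by
  obtain ⟨H, n, F, hH, hcyc, hF, hFk, hk⟩ := A.toDeletionStrategy.forces_succ k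
  refine ⟨n, truncate H n, offlineOpt_pos (mt (isAcyclic_of_truncate hH) hcyc),
    hF.offlineOpt_truncate_le.trans hFk, ?_⟩
  calc 4 * k + 1 ≤ #(A.toDeletionStrategy.deleted H n) := hk
    _ = #(A.select (truncate H n) ∪ A.reserve (truncate H n)) := card_map _
    _ ≤ _ := card_union_le _ _

/-- A convex combination of `opt ≤ |S| + |T|` and `|S| + |R| ≤ |S| + |T| + |R|`. -/
lemma le_cost (hβα : β ≤ α) (hβ1 : β ≤ 1) (G : SimpleGraph (Fin n)) :
    (1 - β : ℝ) * offlineOpt G + β * (#(A.select G) + #(A.reserve G)) ≤ A.cost α G := by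
  have opt_le : (offlineOpt G : ℝ) ≤ #(A.select G) + completionNumber G (A.select G) :=
    mod_cast offlineOpt_le_card_add_completionNumber G (A.select G)
  have hβ1' : 0 ≤ (1 - β : ℝ) := sub_nonneg.mpr (mod_cast hβ1)
  have hT : 0 ≤ (β : ℝ) * completionNumber G (A.select G) := by positivity
  calc (1 - β : ℝ) * offlineOpt G + β * (#(A.select G) + #(A.reserve G))
      ≤ (1 - β : ℝ) * (#(A.select G) + completionNumber G (A.select G)) +
          β * (#(A.select G) + #(A.reserve G)) := by gcongr
    _ ≤ #(A.select G) + completionNumber G (A.select G) + β * #(A.reserve G) := by linarith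
    _ ≤ #(A.select G) + completionNumber G (A.select G) + α * #(A.reserve G) := by gcongr
    _ = A.cost α G := by simp [cost]

lemma cost_div_offlineOpt_le_competitiveRatio (G : SimpleGraph (Fin n)) :
    (A.cost α G : ℝ≥0∞) / offlineOpt G ≤ A.competitiveRatio α :=
  le_iSup₂ (f := fun (n : ℕ) (G : SimpleGraph (Fin n)) =>
    (A.cost α G : ℝ≥0∞) / (offlineOpt G : ℝ≥0∞)) n G

lemma ofReal_le_competitiveRatio (hβα : β ≤ α) (hβ1 : β ≤ 1) (k : ℕ) :
    ENNReal.ofReal (1 + 3 * β - 3 * β * (1 / ((k : ℝ) + 1))) ≤ A.competitiveRatio α := by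
  obtain ⟨n, G, hpos, hle, hcard⟩ := A.exists_le_card_select_add_card_reserve k
  refine le_trans ?_ (A.cost_div_offlineOpt_le_competitiveRatio G)
  have hpos' : (0 : ℝ) < offlineOpt G := mod_cast hpos
  have hcard' : (4 * k + 1 : ℝ) ≤ #(A.select G) + #(A.reserve G) := mod_cast hcard
  rw [← ENNReal.ofReal_coe_nnreal, ← ENNReal.ofReal_natCast, ← ENNReal.ofReal_div_of_pos hpos']
  refine ENNReal.ofReal_le_ofReal ?_
  calc (1 + 3 * β - 3 * β * (1 / ((k : ℝ) + 1)) : ℝ)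
      = (1 - β) + β * ((4 * k + 1) / (k + 1)) := by field
    _ ≤ (1 - β) + β * ((#(A.select G) + #(A.reserve G)) / offlineOpt G) := by
        gcongr
        exact_mod_cast hle
    _ = ((1 - β) * offlineOpt G + β * (#(A.select G) + #(A.reserve G))) / offlineOpt G := by field
    _ ≤ A.cost α G / offlineOpt G := by gcongr; exact A.le_cost hβα hβ1 G

theorem one_add_three_mul_le_competitiveRatio (hβα : β ≤ α) (hβ1 : β ≤ 1) :
    1 + 3 * (β : ℝ≥0∞) ≤ A.competitiveRatio α := by
  have tendsto_bound : Tendsto (fun k : ℕ => (1 + 3 * β - 3 * β * (1 / ((k : ℝ) + 1)) : ℝ)) atTop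
      (𝓝 ((1 + 3 * β : ℝ≥0) : ℝ)) := by
    simpa using (tendsto_one_div_add_atTop_nhds_zero_nat.const_mul (3 * β : ℝ)).const_sub
      (1 + 3 * β : ℝ)
  have hlimit := le_of_tendsto' (ENNReal.tendsto_ofReal tendsto_bound)
    (A.ofReal_le_competitiveRatio hβα hβ1)
  rw [ENNReal.ofReal_coe_nnreal] at hlimit
  exact_mod_cast hlimit

end ReservationAlgorithm

end Cost

end DelayedFVS

theorem mainTheorem8 (α : ℝ≥0) :
    ¬ ∃ A : DelayedFVS.ReservationAlgorithm,
      A.competitiveRatio α < min (1 + 3 * (α : ℝ≥0∞)) 4 := by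
  rintro ⟨A, hA⟩
  refine hA.not_ge ?_
  rcases le_total α 1 with hα | hα
  · exact (min_le_left _ _).trans (A.one_add_three_mul_le_competitiveRatio le_rfl hα)
  · calc min (1 + 3 * (α : ℝ≥0∞)) 4 ≤ 1 + 3 * ((1 : ℝ≥0) : ℝ≥0∞) :=
          (min_le_right _ _).trans_eq (by norm_num)
      _ ≤ A.competitiveRatio α := A.one_add_three_mul_le_competitiveRatio hα le_rfl
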